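/- A Poisson binomial distribution (PBD) of order $n\ge 1$ with parameter vector $\mathbf p=(p_1,\dots,p_n)\in[0,1]^n$ is the law of a sum of $n$ independent $0/1$ Bernoulli random variables with means $p_1,\dots,p_n$. For $k\ge 1$ its $k$-th power $P_k$ is the PBD with parameter vector $(p_1^k,\dots,p_n^k)$. A learning algorithm receives $n$ and rational numbers $\varepsilon,\delta\in(0,1)$ as input, may (adaptively) request independent samples from the powers, and computes its next request or its final output from its input and the samples received so far. Theorem. There are a learning algorithm and an absolute constant $C>0$ such that for all $n\ge 1$ and all rational $\varepsilon,\delta\in(0,1)$ the following holds. The algorithm draws, in total, at most $$\max\bigl(1,\log_2(1/\delta)\bigr)\cdot 2^{\,C\,n\max(\log_2(1/\varepsilon),\,\log_2 n)}$$ samples, all of them from the powers $P_1,\dots,P_n$, and for every PBD of order $n$ with parameter vector $\mathbf p$ it outputs, with probability at least $1-\delta$, a vector $\hat{\mathbf p}\in\mathbb Q^n$ such that, after a suitable reordering of the entries of $\mathbf p$, $$\|\mathbf p-\hat{\mathbf p}\|_\infty=\max_{1\le i\le n}|p_i-\hat p_i|\le\varepsilon .$$ In particular, for every constant success probability less than $1$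 and $n\ge 2$, $2^{O(n\max(\log(1/\varepsilon),\log n))}$ samples suffice. -/

import Mathlib

open MeasureTheory ProbabilityTheory

noncomputable section

/-- The Poisson binomial distribution with parameter vector `p`: the law of `∑ i, X i` for
independent `0/1`-valued Bernoulli variables `X i` with `𝔼[X i] = p i`. -/
def poissonBinomial {n : ℕ} (p : Fin n → unitInterval) : Measure ℕ :=
  (Measure.pi fun i => bernoulliMeasure (1 : ℕ) 0 (p i)).map fun x => ∑ i, x i

instance poissonBinomial_isProbabilityMeasure {n : ℕ} (p : Fin n → unitInterval) :
    IsProbabilityMeasure (poissonBinomial p) :=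
  Measure.isProbabilityMeasure_map (Measurable.of_discrete (α := Fin n → ℕ)).aemeasurable

/-- The `k`-th power `P_k` of the PBD with parameter vector `p`: the PBD with parameters
`p i ^ k`, as a probability mass function on `ℕ`. -/
def pbdPower {n : ℕ} (p : Fin n → unitInterval) (k : ℕ) : PMF ℕ :=
  (poissonBinomial fun i => p i ^ k).toPMF

/-- The real number represented by a fraction of natural numbers. -/
def fracVal (q : ℕ × ℕ) : ℝ := (q.1 : ℝ) / (q.2 : ℝ)

/-- Input of a learning algorithm: the order `n`, the accuracy `ε` and the failure probability
`δ`, the last two given as fractions. -/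
abbrev LearnerInput : Type := ℕ × (ℕ × ℕ) × (ℕ × ℕ)

/-- What a learning algorithm does next: `Sum.inl k` asks for a fresh independent sample from the
`k`-th power, `Sum.inr v` stops and returns the list of fractions `v`. -/
abbrev LearnerAction : Type := ℕ ⊕ List (ℕ × ℕ)

/-- A (possibly adaptive) learning algorithm with sample access to the powers of a PBD.
Its next action is computed from its input and from the samples received so far
(most recent sample first). -/
structure PowerLearner where
  next : LearnerInput × List ℕ → LearnerAction
  computable_next : Computable next

namespace PowerLearner

/-- The law of the output of the algorithm when queries to the `k`-th power are answered by
independent samples from `P k`, the samples in `h` have already been received, and at most `N`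
more samples may be drawn; `none` means that the algorithm asked for more samples than that. -/
def outputLaw (A : PowerLearner) (x : LearnerInput) (P : ℕ → PMF ℕ) :
    ℕ → List ℕ → PMF (Option (List (ℕ × ℕ)))
  | 0, h =>
    match A.next (x, h) with
    | Sum.inl _ => PMF.pure none
    | Sum.inr v => PMF.pure (some v)
  | N + 1, h =>
    match A.next (x, h) with
    | Sum.inl k => (P k).bind fun s => outputLaw A x P N (s :: h)
    | Sum.inr v => PMF.pure (some v)

/-- On input `x` the algorithm never draws more than `N` samples, whatever their values. -/
def DrawsAtMost (A : PowerLearner) (x : LearnerInput) (N : ℕ) : Prop :=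
  ∀ h : List ℕ, h.length = N → ∃ v, A.next (x, h) = Sum.inr v

/-- On input `x` the algorithm samples only from the powers with index in `{1, …, m}`. -/
def QueriesOnly (A : PowerLearner) (x : LearnerInput) (m : ℕ) : Prop :=
  ∀ (h : List ℕ) (k : ℕ), A.next (x, h) = Sum.inl k → 1 ≤ k ∧ k ≤ m

end PowerLearner

/-- The list `v` is a vector of `n` numbers that agrees with the parameter vector `p` up to an
error of at most `ε` in the sup norm, the order of the parameters being immaterial
(a PBD determines its parameters only up to order). -/
def IsParamEstimate {n : ℕ} (p : Fin n → unitInterval) (ε : ℝ) (v : List (ℕ × ℕ)) : Prop :=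
  ∃ q : Fin n → ℕ × ℕ, v = List.ofFn q ∧
    ∃ σ : Equiv.Perm (Fin n), ‖fun i => (p (σ i) : ℝ) - fracVal (q i)‖ ≤ ε

end

/-!
# Learning Poisson binomial distributions

The learner draws samples of the first power only. Their empirical distribution determines the
distribution up to a small error, and Poisson binomial distributions that are close in total
variation have parameters that are close up to a permutation.
-/

/-! The first power alone suffices. Its law has finite support and its point masses are the
coefficients of `genPoly p`, so everything reduces to a stability estimate for these coefficients,
plus sampling and a finite search.

Stability (`exists_perm_abs_sub_le`): homogenising `genPoly` at `(z - 1) / z` expresses `∏ (z - p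
j)` linearly in the coefficients, so close coefficients give close products at every `z = t + y I`
with `t` in `[0, 1]`. Suppose the sorted vectors satisfy `p i + ε ≤ q i`, and let `t` be the
midpoint. Near the real axis at least `i + 1` roots `p j` lie clearly to the left of `t` but at most
`i` roots `q j` do, so the arguments of the two products differ by almost `π` or more; for large `y`
they nearly agree. At some intermediate height they differ by exactly `π / 2`, and there the
products are at least `y ^ n` apart. Hence the coefficients differ by at least `(ε / (2 n + 3)) ^ n`
in `ℓ¹`.

Sampling (`PowerLearner.le_outputLaw`): an exponential supermartingale shows that all `n + 1`
frequencies are within `1 / H` of the point masses, where `H = toleranceDenom x`. Rounding `p` to a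
grid of mesh `1 / (n H)` moves each coefficient by at most `1 / H`, so some grid vector fits the
samples up to `2 / H`; every grid vector that fits is then within `3 / H` of the truth in each
coefficient, and stability applies. The search uses natural number arithmetic only, so it is
primitive recursive. -/

/-! ### The generating polynomial and the law it describes -/

/-- The probability generating polynomial `∏ i, (1 - p i + p i X)`. -/
noncomputable def genPoly {n : ℕ} (p : Fin n → ℝ) : Polynomial ℝ :=
  ∏ i, (Polynomial.C (1 - p i) + Polynomial.C (p i) * Polynomial.X)

lemma genPoly_natDegree_le {n : ℕ} (p : Fin n → ℝ) : (genPoly p).natDegree ≤ n := by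
  refine (Polynomial.natDegree_prod_le _ _).trans ?_
  refine (Finset.sum_le_card_nsmul _ _ 1 fun i _ => ?_).trans (by simp)
  rw [add_comm]
  exact Polynomial.natDegree_linear_le

lemma genPoly_eval {n : ℕ} (p : Fin n → ℝ) (a : ℝ) :
    (genPoly p).eval a = ∏ i, (1 - p i + p i * a) := by
  simp [genPoly, Polynomial.eval_prod]

lemma genPoly_coeff_of_lt {n : ℕ} (p : Fin n → ℝ) {k : ℕ} (h : n < k) :
    (genPoly p).coeff k = 0 :=
  Polynomial.coeff_eq_zero_of_natDegree_lt ((genPoly_natDegree_le p).trans_lt h)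

lemma poissonBinomial_ae_le {n : ℕ} (p : Fin n → unitInterval) :
    ∀ᵐ k ∂poissonBinomial p, k < n + 1 := by
  rw [poissonBinomial, ae_map_iff (Measurable.of_discrete (α := Fin n → ℕ)).aemeasurable
    (MeasurableSet.of_discrete)]
  have h : ∀ i, ∀ᵐ x ∂(Measure.pi fun i => bernoulliMeasure (1 : ℕ) 0 (p i)), x i ≤ 1 := by
    intro i
    refine (measurePreserving_eval (fun i => bernoulliMeasure (1 : ℕ) 0 (p i))
      i).quasiMeasurePreserving.ae (p := fun x => x ≤ 1) ?_
    rw [ae_iff]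
    exact bernoulliMeasure_apply_of_notMem_of_notMem _ MeasurableSet.of_discrete (by simp) (by simp)
  filter_upwards [ae_all_iff.2 h] with x hx
  have := Finset.sum_le_card_nsmul Finset.univ x 1 fun i _ => hx i
  simp only [Finset.card_univ, Fintype.card_fin, smul_eq_mul, mul_one] at this
  exact Nat.lt_succ_of_le this

lemma poissonBinomial_integral_pow {n : ℕ} (p : Fin n → unitInterval) (a : ℝ) :
    ∫ k, a ^ k ∂poissonBinomial p = (genPoly fun i => (p i : ℝ)).eval a := by
  rw [poissonBinomial, integral_map (Measurable.of_discrete (α := Fin n → ℕ)).aemeasurable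
    (Measurable.of_discrete).aestronglyMeasurable, genPoly_eval]
  simp_rw [← Finset.prod_pow_eq_pow_sum]
  rw [integral_fintype_prod_eq_prod (𝕜 := ℝ) (fun (_ : Fin n) (k : ℕ) => a ^ k)]
  refine Finset.prod_congr rfl fun i _ => ?_
  rw [integral_bernoulliMeasure]
  simp
  ring

/-- The mean of `a ^ k` is a polynomial in `a` on both sides, and real polynomials equal at every
point have equal coefficients. -/
lemma poissonBinomial_real_singleton {n : ℕ} (p : Fin n → unitInterval) (k : ℕ) :
    (poissonBinomial p).real {k} = (genPoly fun i => (p i : ℝ)).coeff k := by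
  set μ := poissonBinomial p
  let Q : Polynomial ℝ := ∑ j ∈ Finset.range (n + 1), Polynomial.monomial j (μ.real {j})
  have hQ : Q = genPoly fun i => (p i : ℝ) := by
    refine Polynomial.funext fun a => ?_
    rw [← poissonBinomial_integral_pow]
    have : ∀ᵐ x ∂μ, a ^ x = ∑ j ∈ Finset.range (n + 1),
        ({j} : Set ℕ).indicator (fun _ => a ^ j) x := by
      filter_upwards [poissonBinomial_ae_le p] with x hx
      rw [Finset.sum_eq_single_of_mem x (by simpa using hx)]
      · simp
      · intro j _ hj
        simp [hj.symm]
    rw [integral_congr_ae this, integral_finsetSum]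
    · simp [Q, Polynomial.eval_finsetSum, integral_indicator_const, -Set.indicator_singleton]
    · intro j _
      exact (integrable_const _).indicator MeasurableSet.of_discrete
  rw [← hQ, Polynomial.finsetSum_coeff]
  simp only [Polynomial.coeff_monomial, Finset.sum_ite_eq', Finset.mem_range]
  split_ifs with h
  · rfl
  · rw [measureReal_def, measure_mono_null _ (ae_iff.1 (poissonBinomial_ae_le p))]
    · simp
    · simpa using h

lemma pbdPower_one_apply {n : ℕ} (p : Fin n → unitInterval) (k : ℕ) :
    pbdPower p 1 k = ENNReal.ofReal ((genPoly fun i => (p i : ℝ)).coeff k) := by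
  rw [← poissonBinomial_real_singleton, pbdPower, Measure.toPMF_apply]
  simp

lemma genPoly_succ {n : ℕ} (p : Fin (n + 1) → ℝ) :
    genPoly p = (Polynomial.C (1 - p 0) + Polynomial.C (p 0) * Polynomial.X) *
      genPoly (fun i => p i.succ) := by
  rw [genPoly, Fin.prod_univ_succ]; rfl

lemma genPoly_coeff_succ_zero {n : ℕ} (p : Fin (n + 1) → ℝ) :
    (genPoly p).coeff 0 = (1 - p 0) * (genPoly fun i => p i.succ).coeff 0 := by
  simp [genPoly_succ, Polynomial.mul_coeff_zero]

lemma genPoly_coeff_succ_succ {n : ℕ} (p : Fin (n + 1) → ℝ) (k : ℕ) :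
    (genPoly p).coeff (k + 1) = (1 - p 0) * (genPoly fun i => p i.succ).coeff (k + 1) +
      p 0 * (genPoly fun i => p i.succ).coeff k := by
  rw [genPoly_succ, add_mul, Polynomial.coeff_add, mul_assoc, Polynomial.coeff_C_mul,
    Polynomial.coeff_C_mul, Polynomial.coeff_X_mul]

lemma genPoly_coeff_sum {n : ℕ} (p : Fin n → ℝ) :
    ∑ k ∈ Finset.range (n + 1), (genPoly p).coeff k = 1 := by
  have := Polynomial.eval_eq_sum_range' (Nat.lt_succ_of_le (genPoly_natDegree_le p)) 1
  rw [genPoly_eval] at this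
  simpa using this.symm

lemma genPoly_coeff_nonneg {n : ℕ} (p : Fin n → ℝ) (hp : ∀ i, p i ∈ Set.Icc (0 : ℝ) 1) (k : ℕ) :
    0 ≤ (genPoly p).coeff k := by
  induction n generalizing k with
  | zero => simp only [genPoly, Finset.univ_eq_empty, Finset.prod_empty, Polynomial.coeff_one]
            split_ifs <;> simp
  | succ n ih =>
    have h0 := (hp 0).1
    have h1 := sub_nonneg.2 (hp 0).2
    have h := ih (fun i => p i.succ) fun i => hp _
    cases k with
    | zero => rw [genPoly_coeff_succ_zero]; exact mul_nonneg h1 (h 0)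
    | succ k =>
      rw [genPoly_coeff_succ_succ]
      exact add_nonneg (mul_nonneg h1 (h _)) (mul_nonneg h0 (h _))

lemma genPoly_coeff_le_one {n : ℕ} (p : Fin n → ℝ) (hp : ∀ i, p i ∈ Set.Icc (0 : ℝ) 1) (k : ℕ) :
    (genPoly p).coeff k ≤ 1 := by
  by_cases h : n < k
  · simp [genPoly_coeff_of_lt p h]
  · rw [← genPoly_coeff_sum p]
    exact Finset.single_le_sum (f := fun k => (genPoly p).coeff k)
      (fun i _ => genPoly_coeff_nonneg p hp i) (by simpa [Nat.lt_succ_iff] using h)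

/-- Split off one factor: each coefficient is a convex combination, with weights `1 - p 0` and `p
0`, of coefficients for the remaining parameters. Changing the weights costs at most `|p 0 - q 0|`
because those coefficients lie in `[0, 1]`. -/
lemma abs_genPoly_coeff_sub_le {n : ℕ} (p q : Fin n → ℝ) (hp : ∀ i, p i ∈ Set.Icc (0 : ℝ) 1)
    (hq : ∀ i, q i ∈ Set.Icc (0 : ℝ) 1) (k : ℕ) :
    |(genPoly p).coeff k - (genPoly q).coeff k| ≤ ∑ i, |p i - q i| := by
  induction n generalizing k with
  | zero => simp [genPoly]
  | succ n ih =>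
    rw [Fin.sum_univ_succ]
    set F := genPoly fun i => p i.succ with hF
    set G := genPoly fun i => q i.succ with hG
    set D := ∑ i : Fin n, |p i.succ - q i.succ|
    have h0 := (hp 0).1
    have h1 := sub_nonneg.2 (hp 0).2
    have hd (k) : |F.coeff k - G.coeff k| ≤ D :=
      ih (fun i => p i.succ) (fun i => q i.succ) (fun i => hp _) (fun i => hq _) k
    have hG0 (k) : 0 ≤ G.coeff k := genPoly_coeff_nonneg _ (fun i => hq _) k
    have hG1 (k) : G.coeff k ≤ 1 := genPoly_coeff_le_one _ (fun i => hq _) k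
    have key (a : ℝ) (ha : |a| ≤ 1) : |(p 0 - q 0) * a| ≤ |p 0 - q 0| := by
      rw [abs_mul]; exact mul_le_of_le_one_right (abs_nonneg _) ha
    cases k with
    | zero =>
      rw [genPoly_coeff_succ_zero, genPoly_coeff_succ_zero, ← hF, ← hG]
      have e : (1 - p 0) * F.coeff 0 - (1 - q 0) * G.coeff 0 =
        (1 - p 0) * (F.coeff 0 - G.coeff 0) + (p 0 - q 0) * (-G.coeff 0) := by ring
      rw [e]
      have k1 := key (-G.coeff 0) (by rw [abs_neg, abs_le]; constructor <;> linarith [hG0 0, hG1 0])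
      have k2 : |(1 - p 0) * (F.coeff 0 - G.coeff 0)| ≤ D := by
        rw [abs_mul, abs_of_nonneg h1]
        nlinarith [hd 0, abs_nonneg (F.coeff 0 - G.coeff 0)]
      linarith [abs_add_le ((1 - p 0) * (F.coeff 0 - G.coeff 0)) ((p 0 - q 0) * (-G.coeff 0))]
    | succ k =>
      rw [genPoly_coeff_succ_succ, genPoly_coeff_succ_succ, ← hF, ← hG]
      have e : (1 - p 0) * F.coeff (k + 1) + p 0 * F.coeff k -
          ((1 - q 0) * G.coeff (k + 1) + q 0 * G.coeff k) =
        ((1 - p 0) * (F.coeff (k + 1) - G.coeff (k + 1)) + p 0 * (F.coeff k - G.coeff k)) +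
          (p 0 - q 0) * (G.coeff k - G.coeff (k + 1)) := by ring
      rw [e]
      have k1 := key (G.coeff k - G.coeff (k + 1))
        (by rw [abs_le]; constructor <;> linarith [hG0 k, hG1 k, hG0 (k + 1), hG1 (k + 1)])
      have k2 : |(1 - p 0) * (F.coeff (k + 1) - G.coeff (k + 1)) + p 0 * (F.coeff k - G.coeff k)|
          ≤ D := by
        refine (abs_add_le _ _).trans ?_
        rw [abs_mul, abs_mul, abs_of_nonneg h1, abs_of_nonneg h0]
        nlinarith [hd k, hd (k + 1)]
      exact (abs_add_le _ _).trans (by linarith)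

/-! ### Stability of the parameters -/

/-- Each factor satisfies `z - p = z * (1 - p + p * ((z - 1) / z))`. -/
lemma prod_sub_eq_sum_genPoly_coeff {n : ℕ} (p : Fin n → ℝ) {z : ℂ} (hz : z ≠ 0) :
    ∏ i, (z - p i) =
      ∑ k ∈ Finset.range (n + 1), ((genPoly p).coeff k : ℂ) * (z ^ (n - k) * (z - 1) ^ k) := by
  have h1 := Polynomial.eval₂_eq_sum_range' Complex.ofRealHom
    (Nat.lt_succ_of_le (genPoly_natDegree_le p)) ((z - 1) / z)
  have h2 : (genPoly p).eval₂ Complex.ofRealHom ((z - 1) / z) =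
      ∏ i, (1 - p i + p i * ((z - 1) / z)) := by
    simp [genPoly, Polynomial.eval₂_finsetProd]
  have h3 : ∏ i, (z - p i) = z ^ n * ∏ i, (1 - p i + p i * ((z - 1) / z)) := by
    rw [← Fin.prod_const n z, ← Finset.prod_mul_distrib]
    refine Finset.prod_congr rfl fun i _ => ?_
    field_simp
    ring
  rw [h3, ← h2, h1, Finset.mul_sum]
  refine Finset.sum_congr rfl fun k hk => ?_
  have hk : k ≤ n := Nat.lt_succ_iff.1 (Finset.mem_range.1 hk)
  have hzn : z ^ n = z ^ (n - k) * z ^ k := by rw [← pow_add, Nat.sub_add_cancel hk]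
  rw [div_pow, hzn]
  simp only [Complex.ofRealHom_eq_coe]
  field_simp

/-- Writing the argument through `arctan` avoids branch cuts: sums of these angles depend
continuously on `y > 0`, as the intermediate value theorem will need. -/
lemma exists_add_mul_I_eq_mul_exp (x : ℝ) {y : ℝ} (hy : 0 < y) :
    ∃ r : ℝ, y ≤ r ∧
      (x : ℂ) + y * Complex.I = r * Complex.exp ((Real.pi / 2 - Real.arctan (x / y) : ℝ) * Complex.I) := by
  set s := √(1 + (x / y) ^ 2) with hs
  have hs1 : 1 ≤ s := Real.one_le_sqrt.2 (by nlinarith [sq_nonneg (x / y)])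
  have hs0 : (s : ℂ) ≠ 0 := by exact_mod_cast (by linarith : s ≠ 0)
  have hy0 : (y : ℂ) ≠ 0 := by exact_mod_cast hy.ne'
  refine ⟨y * s, by nlinarith, ?_⟩
  rw [Complex.exp_mul_I, ← Complex.ofReal_cos, ← Complex.ofReal_sin, Real.cos_pi_div_two_sub,
    Real.sin_pi_div_two_sub, Real.sin_arctan, Real.cos_arctan, ← hs]
  push_cast
  field_simp

lemma exists_prod_sub_eq_mul_exp {n : ℕ} (p : Fin n → ℝ) (t : ℝ) {y : ℝ} (hy : 0 < y) :
    ∃ r : ℝ, y ^ n ≤ r ∧ ∏ i, ((t + y * Complex.I : ℂ) - p i) =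
      r * Complex.exp ((n * (Real.pi / 2) - ∑ i, Real.arctan ((t - p i) / y) : ℝ) * Complex.I) := by
  choose r hr h using fun i => exists_add_mul_I_eq_mul_exp (t - p i) hy
  refine ⟨∏ i, r i, ?_, ?_⟩
  · rw [← Fin.prod_const n y]
    exact Finset.prod_le_prod (fun _ _ => hy.le) fun i _ => hr i
  · have e : (n * (Real.pi / 2) - ∑ i, Real.arctan ((t - p i) / y) : ℝ) =
        ∑ i, (Real.pi / 2 - Real.arctan ((t - p i) / y)) := by
      simp
    rw [e, Complex.ofReal_sum, Finset.sum_mul, Complex.exp_sum, Complex.ofReal_prod,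
      ← Finset.prod_mul_distrib]
    refine Finset.prod_congr rfl fun i _ => ?_
    rw [← h i]
    push_cast
    ring

lemma norm_prod_sub_prod_le {n : ℕ} (p q : Fin n → ℝ) {t y : ℝ} (ht : t ∈ Set.Icc (0 : ℝ) 1)
    (hy : 0 < y) :
    ‖∏ i, ((t + y * Complex.I : ℂ) - p i) - ∏ i, ((t + y * Complex.I : ℂ) - q i)‖ ≤
      (∑ k ∈ Finset.range (n + 1), |(genPoly p).coeff k - (genPoly q).coeff k|) *
        (1 + y) ^ n := by
  set z : ℂ := t + y * Complex.I with hz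
  have hz0 : z ≠ 0 := fun h => hy.ne' (by simpa [hz] using congrArg Complex.im h)
  have n1 : ‖z‖ ≤ 1 + y := by
    refine (norm_add_le _ _).trans ?_
    simp [abs_of_pos hy, abs_of_nonneg ht.1, ht.2]
  have n2 : ‖z - 1‖ ≤ 1 + y := by
    have : z - 1 = ((t - 1 : ℝ) : ℂ) + y * Complex.I := by rw [hz]; push_cast; ring
    rw [this]
    refine (norm_add_le _ _).trans ?_
    rw [Complex.norm_real, norm_mul, Complex.norm_real, Complex.norm_I, mul_one, Real.norm_eq_abs,
      Real.norm_eq_abs, abs_of_pos hy, abs_of_nonpos (by linarith [ht.2])]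
    linarith [ht.1]
  rw [prod_sub_eq_sum_genPoly_coeff p hz0, prod_sub_eq_sum_genPoly_coeff q hz0,
    ← Finset.sum_sub_distrib, Finset.sum_mul]
  refine (norm_sum_le _ _).trans (Finset.sum_le_sum fun k hk => ?_)
  have hk : k ≤ n := Nat.lt_succ_iff.1 (Finset.mem_range.1 hk)
  rw [← sub_mul, ← Complex.ofReal_sub, norm_mul, Complex.norm_real, Real.norm_eq_abs, norm_mul,
    norm_pow, norm_pow]
  refine mul_le_mul_of_nonneg_left ?_ (abs_nonneg _)
  calc ‖z‖ ^ (n - k) * ‖z - 1‖ ^ k ≤ (1 + y) ^ (n - k) * (1 + y) ^ k := by gcongr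
    _ = (1 + y) ^ n := by rw [← pow_add, Nat.sub_add_cancel hk]

/-- The two sums of arguments differ by a right angle, so the two products are at least as far
apart as each of them is from zero. -/
lemma div_pow_le_sum_abs_coeff_sub {n : ℕ} (p q : Fin n → ℝ) {t y : ℝ}
    (ht : t ∈ Set.Icc (0 : ℝ) 1) (hy : 0 < y)
    (h : ∑ i, (Real.arctan ((t - p i) / y) - Real.arctan ((t - q i) / y)) = Real.pi / 2) :
    (y / (1 + y)) ^ n ≤
      ∑ k ∈ Finset.range (n + 1), |(genPoly p).coeff k - (genPoly q).coeff k| := by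
  obtain ⟨r, hr, hp⟩ := exists_prod_sub_eq_mul_exp p t hy
  obtain ⟨s, -, hq⟩ := exists_prod_sub_eq_mul_exp q t hy
  have hle := norm_prod_sub_prod_le p q ht hy
  rw [Finset.sum_sub_distrib] at h
  set a := n * (Real.pi / 2) - ∑ i, Real.arctan ((t - p i) / y) with ha
  have hb : n * (Real.pi / 2) - ∑ i, Real.arctan ((t - q i) / y) = a + Real.pi / 2 := by
    rw [ha]; linarith
  have e : (r * Complex.exp (a * Complex.I) - s * Complex.exp ((a + Real.pi / 2 : ℝ) * Complex.I) : ℂ)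
      = Complex.exp (a * Complex.I) * ((r : ℂ) - s * Complex.I) := by
    rw [Complex.ofReal_add, add_mul, Complex.exp_add]
    push_cast
    rw [Complex.exp_pi_div_two_mul_I]
    ring
  rw [hp, hq, hb, e, norm_mul, Complex.norm_exp_ofReal_mul_I, one_mul] at hle
  -- After the common rotation is removed the two products are perpendicular, and the real part `r`
  -- bounds the distance from below.
  have h1 : r ≤ ‖(r : ℂ) - s * Complex.I‖ := by
    refine le_trans ?_ (Complex.re_le_norm _)
    simp
  rw [div_pow, div_le_iff₀ (by positivity)]
  linarith

/-- At this height, `t` is at least `n + 1` times the height away from every `p j` with `j ≤ i` (on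
the right of it) and from every `q j` with `j ≥ i` (on the left of it). Index `i` contributes at
least `2 A`, nearly `π`, and every other index loses at most `π / 2 - A ≤ 1 / (n + 1)`. -/
lemma pi_div_two_le_sum_arctan_sub {n : ℕ} {p q : Fin n → ℝ} (hp : Monotone p) (hq : Monotone q)
    {ε : ℝ} (hε : 0 < ε) {i : Fin n} (hi : p i + ε ≤ q i) :
    Real.pi / 2 ≤ ∑ j, (Real.arctan (((p i + q i) / 2 - p j) / (ε / (2 * (n + 1)))) -
      Real.arctan (((p i + q i) / 2 - q j) / (ε / (2 * (n + 1))))) := by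
  set A := Real.arctan (n + 1) with hA
  set y := ε / (2 * (n + 1 : ℝ)) with hy
  have hn : (0 : ℝ) < n + 1 := by positivity
  have hy0 : 0 < y := by positivity
  have hyn : (n + 1 : ℝ) * y = ε / 2 := by rw [hy]; field_simp
  have hA1 : Real.pi / 2 - 1 / (n + 1) ≤ A := by
    have h1 := Real.arctan_inv_of_pos hn
    have h2 : Real.arctan ((n + 1 : ℝ)⁻¹) ≤ (n + 1 : ℝ)⁻¹ := by
      have h3 : 0 ≤ Real.arctan ((n + 1 : ℝ)⁻¹) := Real.arctan_nonneg.2 (by positivity)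
      have := Real.le_tan h3 (Real.arctan_lt_pi_div_two _)
      rwa [Real.tan_arctan] at this
    rw [one_div]
    linarith
  have hP (j) (hj : j ≤ i) : A ≤ Real.arctan (((p i + q i) / 2 - p j) / y) := by
    refine Real.arctan_strictMono.monotone ?_
    rw [le_div_iff₀ hy0, hyn]
    linarith [hp hj]
  have hQ (j) (hj : i ≤ j) : Real.arctan (((p i + q i) / 2 - q j) / y) ≤ -A := by
    rw [hA, ← Real.arctan_neg]
    refine Real.arctan_strictMono.monotone ?_
    rw [div_le_iff₀ hy0, neg_mul, hyn]
    linarith [hq hj]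
  have hterm (j) : (A - Real.pi / 2) + (if j = i then A + Real.pi / 2 else 0) ≤
      Real.arctan (((p i + q i) / 2 - p j) / y) - Real.arctan (((p i + q i) / 2 - q j) / y) := by
    have b1 := Real.neg_pi_div_two_lt_arctan (((p i + q i) / 2 - p j) / y)
    have b2 := Real.arctan_lt_pi_div_two (((p i + q i) / 2 - q j) / y)
    rcases lt_trichotomy j i with h | h | h
    · rw [if_neg h.ne]; linarith [hP j h.le]
    · subst h; rw [if_pos rfl]; linarith [hP j le_rfl, hQ j le_rfl]
    · rw [if_neg h.ne']; linarith [hQ j h.le]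
  refine le_trans ?_ (Finset.sum_le_sum fun j _ => hterm j)
  rw [Finset.sum_add_distrib]
  simp only [Finset.sum_const, Finset.card_univ, Fintype.card_fin, nsmul_eq_mul,
    Finset.sum_ite_eq', Finset.mem_univ, if_true]
  have h5 : (n + 1 : ℝ) * (1 / (n + 1)) = 1 := by field_simp
  -- The sum is at least `(n + 1) * (A - π / 2) + π ≥ π - 1`, which exceeds `π / 2` since `π > 3`.
  nlinarith [mul_le_mul_of_nonneg_left hA1 hn.le, Real.pi_gt_three]

lemma abs_arctan_sub_arctan_le (a b : ℝ) : |Real.arctan a - Real.arctan b| ≤ |a - b| := by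
  have := Convex.norm_image_sub_le_of_norm_deriv_le (f := Real.arctan) (C := 1) (s := Set.univ)
    (x := b) (y := a) (fun x _ => Real.differentiable_arctan x) (fun x _ => ?_) convex_univ trivial trivial
  · simpa using this
  · rw [Real.deriv_arctan, Real.norm_eq_abs, abs_of_pos (by positivity), div_le_one (by positivity)]
    nlinarith [sq_nonneg x]

lemma le_sum_abs_coeff_sub_of_add_le {n : ℕ} {p q : Fin n → ℝ} (hp : Monotone p) (hq : Monotone q)
    (hp1 : ∀ i, p i ∈ Set.Icc (0 : ℝ) 1) (hq1 : ∀ i, q i ∈ Set.Icc (0 : ℝ) 1)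
    {ε : ℝ} (hε : 0 < ε) (hε1 : ε ≤ 1) {i : Fin n} (hi : p i + ε ≤ q i) :
    (ε / (2 * n + 3)) ^ n ≤
      ∑ k ∈ Finset.range (n + 1), |(genPoly p).coeff k - (genPoly q).coeff k| := by
  set t := (p i + q i) / 2 with htd
  have ht : t ∈ Set.Icc (0 : ℝ) 1 := by
    constructor <;> linarith [(hp1 i).1, (hp1 i).2, (hq1 i).1, (hq1 i).2]
  have hn : (1 : ℝ) ≤ n := by exact_mod_cast (Fin.pos i)
  set y₀ := ε / (2 * (n + 1 : ℝ)) with hy₀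
  have hy0 : 0 < y₀ := by positivity
  have hyn : y₀ ≤ n := by
    rw [hy₀, div_le_iff₀ (by positivity)]; nlinarith
  let θ : ℝ → ℝ := fun y =>
    ∑ j, (Real.arctan ((t - p j) / y) - Real.arctan ((t - q j) / y))
  have hθ0 : Real.pi / 2 ≤ θ y₀ := pi_div_two_le_sum_arctan_sub hp hq hε hi
  -- At height `n` each angle differs by at most `1 / n`, as `arctan` is 1-Lipschitz and the
  -- parameters lie in `[0, 1]`; the total is at most `1 < π / 2`.
  have hθ1 : θ n ≤ Real.pi / 2 := by
    have h1 (j) : Real.arctan ((t - p j) / n) - Real.arctan ((t - q j) / n) ≤ 1 / n := by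
      refine (le_abs_self _).trans ((abs_arctan_sub_arctan_le _ _).trans ?_)
      rw [← sub_div, abs_div, abs_of_nonneg (by linarith : (0 : ℝ) ≤ n)]
      refine div_le_div_of_nonneg_right ?_ (by linarith)
      rw [abs_le]
      constructor <;> linarith [(hp1 j).1, (hp1 j).2, (hq1 j).1, (hq1 j).2]
    have h2 : θ n ≤ ∑ _j : Fin n, (1 / n : ℝ) := Finset.sum_le_sum fun j _ => h1 j
    have h3 : ∑ _j : Fin n, (1 / n : ℝ) = 1 := by
      simp only [Finset.sum_const, Finset.card_univ, Fintype.card_fin, nsmul_eq_mul]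
      field_simp
    linarith [Real.pi_gt_three]
  have hc : ContinuousOn θ (Set.Icc y₀ n) := by
    refine continuousOn_finsetSum _ fun j _ => ?_
    have h0 : ∀ y ∈ Set.Icc y₀ (n : ℝ), y ≠ 0 := fun y hy => (hy0.trans_le hy.1).ne'
    refine ContinuousOn.sub ?_ ?_ <;>
    exact Real.continuous_arctan.comp_continuousOn
      (continuousOn_const.div continuousOn_id h0)
  obtain ⟨y, hy, hθ⟩ := intermediate_value_Icc' hyn hc ⟨hθ1, hθ0⟩
  have hypos : 0 < y := hy0.trans_le hy.1
  refine le_trans ?_ (div_pow_le_sum_abs_coeff_sub p q ht hypos hθ)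
  refine pow_le_pow_left₀ (by positivity) ?_ n
  rw [div_le_div_iff₀ (by positivity) (by positivity)]
  -- The map `y ↦ y / (1 + y)` is increasing and equals `ε / (2 n + 2 + ε)` at `y₀`; `ε ≤ 1` then
  -- gives the denominator `2 n + 3`.
  have h4 : ε = y₀ * (2 * (n + 1)) := by rw [hy₀]; field_simp
  nlinarith [hy.1, mul_le_mul_of_nonneg_right hy.1 (by positivity : (0 : ℝ) ≤ 2 * (n + 1)),
    mul_le_mul_of_nonneg_right hε1 hypos.le]

lemma genPoly_comp_perm {n : ℕ} (p : Fin n → ℝ) (σ : Equiv.Perm (Fin n)) :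
    genPoly (p ∘ σ) = genPoly p := by
  unfold genPoly
  exact Equiv.prod_comp σ fun i => Polynomial.C (1 - p i) + Polynomial.C (p i) * Polynomial.X

/-- Poisson binomial distributions that are close in total variation have close parameters. -/
theorem exists_perm_abs_sub_le {n : ℕ} (p q : Fin n → ℝ)
    (hp1 : ∀ i, p i ∈ Set.Icc (0 : ℝ) 1) (hq1 : ∀ i, q i ∈ Set.Icc (0 : ℝ) 1)
    {ε : ℝ} (hε : 0 < ε) (hε1 : ε ≤ 1)
    (h : ∑ k ∈ Finset.range (n + 1), |(genPoly p).coeff k - (genPoly q).coeff k| <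
      (ε / (2 * n + 3)) ^ n) :
    ∃ σ : Equiv.Perm (Fin n), ∀ i, |p (σ i) - q i| ≤ ε := by
  have hps := Tuple.monotone_sort p
  have hqs := Tuple.monotone_sort q
  -- Match the parameters by rank.
  refine ⟨(Tuple.sort q)⁻¹.trans (Tuple.sort p), fun i => ?_⟩
  obtain ⟨j, rfl⟩ := (Tuple.sort q).surjective i
  have e : ((Tuple.sort q)⁻¹.trans (Tuple.sort p)) (Tuple.sort q j) = Tuple.sort p j := by
    simp
  rw [e]
  by_contra hcon
  rw [not_le, lt_abs] at hcon
  rw [← genPoly_comp_perm p (Tuple.sort p), ← genPoly_comp_perm q (Tuple.sort q)] at h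
  rcases hcon with hcon | hcon
  · refine absurd (le_sum_abs_coeff_sub_of_add_le hqs hps (fun i => hq1 _) (fun i => hp1 _) hε hε1
      (i := j) (by simp only [Function.comp]; linarith)) (not_le.2 ?_)
    simpa only [abs_sub_comm] using h
  · exact absurd (le_sum_abs_coeff_sub_of_add_le hps hqs (fun i => hp1 _) (fun i => hq1 _) hε hε1
      (i := j) (by simp only [Function.comp]; linarith)) (not_le.2 h)

/-! ### Concentration of the empirical frequencies -/

/-- A supermartingale bound for the failure probability of a learner that draws exactly `N`
samples from the first power. -/
lemma PowerLearner.outputLaw_compl_le (A : PowerLearner) (x : LearnerInput) (P : ℕ → PMF ℕ) (N : ℕ)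
    (S : Set (Option (List (ℕ × ℕ)))) (Φ : List ℕ → ENNReal)
    (hq : ∀ h : List ℕ, h.length < N → A.next (x, h) = Sum.inl 1)
    (hend : ∀ h : List ℕ, h.length = N → ∃ v, A.next (x, h) = Sum.inr v ∧ (some v ∉ S → 1 ≤ Φ h))
    (hstep : ∀ h : List ℕ, h.length < N → ∑' s, P 1 s * Φ (s :: h) ≤ Φ h) :
    ∀ (r : ℕ) (h : List ℕ), h.length + r = N → (A.outputLaw x P r h).toOuterMeasure Sᶜ ≤ Φ h := by
  intro r
  induction r with
  | zero =>
    intro h hh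
    obtain ⟨v, hv, hv'⟩ := hend h hh
    rw [outputLaw, hv]
    simp only [PMF.toOuterMeasure_pure_apply, Set.mem_compl_iff]
    split_ifs with hS
    · exact hv' hS
    · exact zero_le
  | succ r ih =>
    intro h hh
    rw [outputLaw, hq h (by omega)]
    simp only [PMF.toOuterMeasure_bind_apply]
    refine le_trans (ENNReal.tsum_le_tsum fun s => ?_) (hstep h (by omega))
    exact mul_le_mul_right (ih (s :: h) (by simp only [List.length_cons]; omega)) _

/-- Uses `exp u ≤ 1 + u + u ^ 2` for `|u| ≤ 1`; the linear term has mean zero. -/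
lemma sum_mul_exp_le {n : ℕ} {a : ℕ → ℝ} (ha : ∀ k, 0 ≤ a k)
    (hs : ∑ k ∈ Finset.range (n + 1), a k = 1) {k : ℕ} (hk : k ∈ Finset.range (n + 1))
    {l : ℝ} (hl : |l| ≤ 1) :
    ∑ s ∈ Finset.range (n + 1), a s * Real.exp (l * ((if s = k then 1 else 0) - a k)) ≤
      Real.exp (l ^ 2) := by
  have hak : a k ≤ 1 := by
    rw [← hs]; exact Finset.single_le_sum (fun i _ => ha i) hk
  have h1 (s : ℕ) : Real.exp (l * ((if s = k then 1 else 0) - a k)) ≤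
      1 + l * ((if s = k then 1 else 0) - a k) + l ^ 2 := by
    set u : ℝ := (if s = k then 1 else 0) - a k with hu
    have hu1 : |u| ≤ 1 := by
      rw [hu, abs_le]; split_ifs <;> constructor <;> linarith [ha k]
    have h2 : |l * u| ≤ |l| := by
      rw [abs_mul]; exact mul_le_of_le_one_right (abs_nonneg _) hu1
    have h3 := (abs_le.1 (Real.abs_exp_sub_one_sub_id_le (h2.trans hl))).2
    have h4 : (l * u) ^ 2 ≤ l ^ 2 := sq_le_sq.2 h2
    linarith
  calc _ ≤ ∑ s ∈ Finset.range (n + 1),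
        a s * (1 + l * ((if s = k then 1 else 0) - a k) + l ^ 2) :=
        Finset.sum_le_sum fun s _ => mul_le_mul_of_nonneg_left (h1 s) (ha s)
    _ = ∑ s ∈ Finset.range (n + 1),
        ((1 - l * a k + l ^ 2) * a s + l * (if s = k then a s else 0)) := by
        refine Finset.sum_congr rfl fun s _ => ?_
        split_ifs <;> ring
    _ = 1 + l ^ 2 := by
        rw [Finset.sum_add_distrib, ← Finset.mul_sum, ← Finset.mul_sum, hs, Finset.sum_ite_eq',
          if_pos hk]
        ring
    _ ≤ Real.exp (l ^ 2) := by linarith [Real.add_one_le_exp (l ^ 2)]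

/-- The exponential moment of the deviation of the number of samples with value `k` from its mean,
normalised for `N` samples and tolerance `η N`. -/
noncomputable def deviationPotential (a : ℕ → ℝ) (N : ℕ) (η l : ℝ) (k : ℕ) (h : List ℕ) : ℝ :=
  Real.exp (l * (h.count k - a k * h.length) - |l| * η * N + l ^ 2 * (N - h.length))

/-- Each sample lowers the term `l ^ 2 * (N - h.length)` by `l ^ 2`, which pays exactly for the
factor from `sum_mul_exp_le`. -/
lemma deviationPotential_step {n : ℕ} {a : ℕ → ℝ} (ha : ∀ k, 0 ≤ a k)
    (hs : ∑ k ∈ Finset.range (n + 1), a k = 1) {k : ℕ} (hk : k ∈ Finset.range (n + 1))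
    {l : ℝ} (hl : |l| ≤ 1) (N : ℕ) (η : ℝ) (h : List ℕ) :
    ∑ s ∈ Finset.range (n + 1), a s * deviationPotential a N η l k (s :: h) ≤
      deviationPotential a N η l k h := by
  have e (s : ℕ) : deviationPotential a N η l k (s :: h) = deviationPotential a N η l k h *
      Real.exp (-l ^ 2) * Real.exp (l * ((if s = k then 1 else 0) - a k)) := by
    simp only [deviationPotential, ← Real.exp_add, List.count_cons, List.length_cons, beq_iff_eq]
    congr 1
    push_cast
    ring
  simp_rw [e, mul_left_comm (a _)]
  rw [← Finset.mul_sum]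
  refine (mul_le_mul_of_nonneg_left (sum_mul_exp_le ha hs hk hl)
    (mul_nonneg (Real.exp_pos _).le (Real.exp_pos _).le)).trans_eq ?_
  rw [mul_assoc, ← Real.exp_add, neg_add_cancel, Real.exp_zero, mul_one]
  rfl

/-- The union bound is built into the supermartingale: `Ψ` adds the potentials over all values `k ≤
n` and both signs of deviation. The choice `l = ± η / 2` minimises the initial exponent `-|l| η N +
l ^ 2 N`. -/
lemma PowerLearner.le_outputLaw (A : PowerLearner) (x : LearnerInput) (P : ℕ → PMF ℕ) (N n : ℕ)
    (S : Set (Option (List (ℕ × ℕ)))) {a : ℕ → ℝ} (ha : ∀ k, 0 ≤ a k)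
    (hs : ∑ k ∈ Finset.range (n + 1), a k = 1) (hP : ∀ k, P 1 k = ENNReal.ofReal (a k))
    (ha0 : ∀ k, n < k → a k = 0) {η δ : ℝ} (hη : 0 < η) (hη1 : η ≤ 1)
    (hδ : 2 * (n + 1) * Real.exp (-(η ^ 2 * N / 4)) ≤ δ)
    (hq : ∀ h : List ℕ, h.length < N → A.next (x, h) = Sum.inl 1)
    (hend : ∀ h : List ℕ, h.length = N → ∃ v, A.next (x, h) = Sum.inr v ∧
      ((∀ k ≤ n, |h.count k - a k * N| ≤ η * N) → some v ∈ S)) :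
    ENNReal.ofReal (1 - δ) ≤ (A.outputLaw x P N []).toOuterMeasure S := by
  set Ψ : List ℕ → ℝ := fun h => ∑ k ∈ Finset.range (n + 1),
    (deviationPotential a N η (η / 2) k h + deviationPotential a N η (-(η / 2)) k h) with hΨ
  have hl1 : |η / 2| ≤ 1 := by rw [abs_of_pos (by linarith)]; linarith
  have hl2 : |-(η / 2)| ≤ 1 := by rwa [abs_neg]
  have hpos (l : ℝ) (k : ℕ) (h : List ℕ) : 0 ≤ deviationPotential a N η l k h := (Real.exp_pos _).le
  have hΨ0 (h) : 0 ≤ Ψ h := Finset.sum_nonneg fun k _ => add_nonneg (hpos _ _ _) (hpos _ _ _)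
  have hmain := A.outputLaw_compl_le x P N S (fun h => ENNReal.ofReal (Ψ h)) hq
    (fun h hh => by
      obtain ⟨v, hv, hvS⟩ := hend h hh
      refine ⟨v, hv, fun hnS => ?_⟩
      have hex : ¬ ∀ k ≤ n, |h.count k - a k * N| ≤ η * N := fun hall => hnS (hvS hall)
      push Not at hex
      obtain ⟨k, hk, hdev⟩ := hex
      rw [ENNReal.one_le_ofReal]
      -- When all `N` samples are in, a deviation above `η N` makes the exponent of the matching
      -- sign nonnegative.
      have h1 : 1 ≤ deviationPotential a N η (η / 2) k h +
          deviationPotential a N η (-(η / 2)) k h := by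
        simp only [deviationPotential, hh, abs_neg, abs_of_pos (half_pos hη), sub_self, mul_zero,
          add_zero]
        rcases lt_abs.1 hdev with hd | hd
        · refine le_add_of_le_of_nonneg (Real.one_le_exp ?_) (Real.exp_pos _).le
          nlinarith
        · refine le_add_of_nonneg_of_le (Real.exp_pos _).le (Real.one_le_exp ?_)
          nlinarith
      exact h1.trans (Finset.single_le_sum (f := fun k => deviationPotential a N η (η / 2) k h +
          deviationPotential a N η (-(η / 2)) k h)
        (fun i _ => add_nonneg (hpos _ _ _) (hpos _ _ _)) (Finset.mem_range.2 (by omega))))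
    (fun h _ => by
      rw [tsum_eq_sum (s := Finset.range (n + 1)) fun k hk => by
        rw [hP, ha0 k (by simpa using hk)]; simp]
      simp_rw [hP, ← ENNReal.ofReal_mul (ha _)]
      rw [← ENNReal.ofReal_sum_of_nonneg fun i _ => mul_nonneg (ha i) (hΨ0 _)]
      refine ENNReal.ofReal_le_ofReal ?_
      simp_rw [hΨ, Finset.mul_sum]
      rw [Finset.sum_comm]
      refine Finset.sum_le_sum fun k hk => ?_
      simp_rw [mul_add, Finset.sum_add_distrib]
      exact add_le_add (deviationPotential_step ha hs hk hl1 N η h)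
        (deviationPotential_step ha hs hk hl2 N η h))
    N [] (by simp)
  have hinit : Ψ [] ≤ δ := by
    refine le_trans (le_of_eq ?_) hδ
    simp only [hΨ, deviationPotential, List.count_nil, List.length_nil, abs_neg,
      abs_of_pos (half_pos hη), Nat.cast_zero, mul_zero, sub_zero, zero_sub, neg_sq,
      Finset.sum_const, Finset.card_range, nsmul_eq_mul, Nat.cast_add, Nat.cast_one]
    have e : -(η / 2 * η * N) + (η / 2) ^ 2 * N = -(η ^ 2 * N / 4) := by ring
    rw [e]
    ring
  have htot : 1 ≤ (A.outputLaw x P N []).toOuterMeasure S +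
      (A.outputLaw x P N []).toOuterMeasure Sᶜ := by
    refine le_trans ?_ (measure_union_le S Sᶜ)
    rw [Set.union_compl_self, (PMF.toOuterMeasure_apply_eq_one_iff _ _).2 (Set.subset_univ _)]
  rw [ENNReal.ofReal_sub _ ((hΨ0 []).trans hinit), ENNReal.ofReal_one, tsub_le_iff_right]
  exact htot.trans (by gcongr; exact hmain.trans (ENNReal.ofReal_le_ofReal hinit))

/-! ### The learner in natural number arithmetic -/

/-- A natural number exceeding `1 / ε`. -/
def accuracyDenom (x : LearnerInput) : ℕ := x.2.1.2 / x.2.1.1 + 1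

/-- The reciprocal of the tolerance with which the empirical distribution is compared to the
candidates. -/
def toleranceDenom (x : LearnerInput) : ℕ :=
  4 * (x.1 + 1) * ((2 * x.1 + 3) * accuracyDenom x) ^ x.1

/-- The candidate parameters are the multiples of the reciprocal of this number. -/
def gridDenom (x : LearnerInput) : ℕ := x.1 * toleranceDenom x

/-- A natural number `d` with `2 ^ d ≥ 1 / δ`. -/
def confidenceBits (x : LearnerInput) : ℕ := Nat.log 2 (x.2.2.2 / x.2.2.1) + 1

/-- For a single parameter and `ε ≥ 1 / 2` no samples are needed. -/
def NeedsNoSamples (x : LearnerInput) : Prop := x.1 = 1 ∧ x.2.1.2 ≤ 2 * x.2.1.1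

instance : DecidablePred NeedsNoSamples := fun _ => inferInstanceAs (Decidable (_ ∧ _))

/-- The number of samples that the learner draws. -/
def sampleCount (x : LearnerInput) : ℕ :=
  if NeedsNoSamples x then 0
  else 4 * toleranceDenom x ^ 2 * (2 * (x.1 + 1) + confidenceBits x)

/-- The `i`-th digit of `c` in base `M + 1`. -/
def gridDigit (M c i : ℕ) : ℕ := c / (M + 1) ^ i % (M + 1)

/-- Multiplication of a polynomial, given by its first `L` coefficients, by `(M - d) + d X`. -/
def mulLinear (M d L : ℕ) (l : List ℕ) : List ℕ :=
  (List.range L).map fun k => (M - d) * l.getD k 0 + d * (if k = 0 then 0 else l.getD (k - 1) 0)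

/-- The first `L` coefficients of `∏ j < i, ((M - d j) + d j X)` for the digits `d j` of `c`. -/
def weightRow (M c L i : ℕ) : List ℕ :=
  Nat.rec [1] (fun j l => mulLinear M (gridDigit M c j) L l) i

/-- The number of samples equal to `k` is compatible with the grid vector encoded by `c`. -/
def FitsAt (x : LearnerInput) (h : List ℕ) (c k : ℕ) : Prop :=
  h.count k * (gridDenom x ^ x.1 * toleranceDenom x) ≤
      (weightRow (gridDenom x) c (x.1 + 1) x.1).getD k 0 * (sampleCount x * toleranceDenom x) +
        2 * (sampleCount x * gridDenom x ^ x.1) ∧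
    (weightRow (gridDenom x) c (x.1 + 1) x.1).getD k 0 * (sampleCount x * toleranceDenom x) ≤
      h.count k * (gridDenom x ^ x.1 * toleranceDenom x) +
        2 * (sampleCount x * gridDenom x ^ x.1)

instance (x : LearnerInput) (h : List ℕ) (c : ℕ) : DecidablePred (FitsAt x h c) :=
  fun _ => inferInstanceAs (Decidable (_ ∧ _))

/-- The samples `h` are compatible with the grid vector encoded by `c`. -/
def Fits (x : LearnerInput) (h : List ℕ) (c : ℕ) : Prop :=
  ∀ k ∈ List.range (x.1 + 1), FitsAt x h c k

instance (x : LearnerInput) (h : List ℕ) : DecidablePred (Fits x h) :=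
  fun _ => inferInstanceAs (Decidable (∀ k ∈ List.range _, _))

/-- A code of a grid vector that is compatible with the samples, if there is one. -/
def bestCode (x : LearnerInput) (h : List ℕ) : ℕ :=
  Nat.findGreatest (Fits x h) ((gridDenom x + 1) ^ x.1)

/-- The output of the learner. -/
def estimate (x : LearnerInput) (h : List ℕ) : List (ℕ × ℕ) :=
  if NeedsNoSamples x then [(1, 2)]
  else (List.range x.1).map fun i =>
    (gridDigit (gridDenom x) (bestCode x h) i, gridDenom x)

/-! ### Primitive recursiveness -/

section Computability

open Primrec

lemma primrec_pow : Primrec₂ ((· ^ ·) : ℕ → ℕ → ℕ) := Primrec₂.unpaired'.1 Nat.Primrec.pow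

lemma primrec_log_two : Primrec (Nat.log 2) := by
  -- The alternative `d = 0` makes the predicate hold at the value `Nat.log 2 0 = 0`.
  refine (Primrec.nat_findGreatest (f := id) (p := fun a d => d = 0 ∨ 2 ^ d ≤ a) Primrec.id
    ((Primrec.eq.comp snd (const 0)).or
      (nat_le.comp (primrec_pow.comp (const 2) snd) fst))).of_eq fun a => ?_
  rcases Nat.eq_zero_or_pos a with rfl | ha
  · simp
  · rw [Nat.findGreatest_eq_iff]
    refine ⟨Nat.log_le_self _ _, fun _ => Or.inr (Nat.pow_log_le_self _ ha.ne'), ?_⟩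
    rintro d hd - (rfl | h)
    · omega
    · exact absurd (Nat.le_log_of_pow_le (by norm_num) h) (not_le.2 hd)

lemma primrec_count : Primrec₂ fun (h : List ℕ) (k : ℕ) => h.count k := by
  refine (list_length.comp (PrimrecRel.listFilter (R := fun a b : ℕ => a = b) Primrec.eq)).of_eq
    fun p => ?_
  simp only [List.count_eq_length_filter]
  congr 1

lemma primrec_accuracyDenom : Primrec accuracyDenom :=
  succ.comp (nat_div.comp (snd.comp (fst.comp snd)) (fst.comp (fst.comp snd)))

lemma primrec_toleranceDenom : Primrec toleranceDenom :=
  nat_mul.comp (nat_mul.comp (const 4) (succ.comp fst))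
    (primrec_pow.comp (nat_mul.comp (nat_add.comp (nat_mul.comp (const 2) fst) (const 3))
      primrec_accuracyDenom) fst)

lemma primrec_gridDenom : Primrec gridDenom := nat_mul.comp fst primrec_toleranceDenom

lemma primrec_confidenceBits : Primrec confidenceBits :=
  succ.comp (primrec_log_two.comp
    (nat_div.comp (snd.comp (snd.comp snd)) (fst.comp (snd.comp snd))))

lemma primrec_needsNoSamples : PrimrecPred NeedsNoSamples :=
  (Primrec.eq.comp fst (const 1)).and
    (nat_le.comp (snd.comp (fst.comp snd)) (nat_mul.comp (const 2) (fst.comp (fst.comp snd))))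

lemma primrec_sampleCount : Primrec sampleCount :=
  ite primrec_needsNoSamples (const 0)
    (nat_mul.comp (nat_mul.comp (const 4) (primrec_pow.comp primrec_toleranceDenom (const 2)))
      (nat_add.comp (nat_mul.comp (const 2) (succ.comp fst)) primrec_confidenceBits))

variable {α : Type*} [Primcodable α] {M c L i d k : α → ℕ}

lemma Primrec.gridDigit (hM : Primrec M) (hc : Primrec c) (hi : Primrec i) :
    Primrec fun a => gridDigit (M a) (c a) (i a) :=
  nat_mod.comp (nat_div.comp hc (primrec_pow.comp (succ.comp hM) hi)) (succ.comp hM)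

lemma Primrec.mulLinear {l : α → List ℕ} (hM : Primrec M) (hd : Primrec d) (hL : Primrec L)
    (hl : Primrec l) : Primrec fun a => mulLinear (M a) (d a) (L a) (l a) :=
  list_map (list_range.comp hL) <| Primrec.to₂ <|
    nat_add.comp
      (nat_mul.comp (nat_sub.comp (hM.comp fst) (hd.comp fst)) ((list_getD 0).comp (hl.comp fst) snd))
      (nat_mul.comp (hd.comp fst) (ite (Primrec.eq.comp snd (const 0)) (const 0)
        ((list_getD 0).comp (hl.comp fst) (nat_sub.comp snd (const 1)))))

lemma Primrec.weightRow (hM : Primrec M) (hc : Primrec c) (hL : Primrec L) (hi : Primrec i) :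
    Primrec fun a => weightRow (M a) (c a) (L a) (i a) :=
  nat_rec' (h := fun a jl => _root_.mulLinear (M a) (_root_.gridDigit (M a) (c a) jl.1) (L a) jl.2)
    hi (const [1]) <| Primrec.to₂ <|
    Primrec.mulLinear (hM.comp fst)
      (Primrec.gridDigit (hM.comp fst) (hc.comp fst) (fst.comp snd)) (hL.comp fst) (snd.comp snd)

lemma primrecRel_fits : PrimrecRel fun (a : LearnerInput × List ℕ) (c : ℕ) => Fits a.1 a.2 c := by
  have hx : Primrec fun b : ℕ × ((LearnerInput × List ℕ) × ℕ) => b.2.1.1 :=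
    fst.comp (fst.comp snd)
  have hC : Primrec fun b : ℕ × ((LearnerInput × List ℕ) × ℕ) =>
      b.2.1.2.count b.1 * (gridDenom b.2.1.1 ^ b.2.1.1.1 * toleranceDenom b.2.1.1) :=
    nat_mul.comp (primrec_count.comp (snd.comp (fst.comp snd)) fst)
      (nat_mul.comp (primrec_pow.comp (primrec_gridDenom.comp hx) (fst.comp hx))
        (primrec_toleranceDenom.comp hx))
  have hW : Primrec fun b : ℕ × ((LearnerInput × List ℕ) × ℕ) =>
      (_root_.weightRow (gridDenom b.2.1.1) b.2.2 (b.2.1.1.1 + 1) b.2.1.1.1).getD b.1 0 *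
        (sampleCount b.2.1.1 * toleranceDenom b.2.1.1) :=
    nat_mul.comp ((list_getD 0).comp (Primrec.weightRow (primrec_gridDenom.comp hx)
      (snd.comp snd) (succ.comp (fst.comp hx)) (fst.comp hx)) fst)
      (nat_mul.comp (primrec_sampleCount.comp hx) (primrec_toleranceDenom.comp hx))
  have hT : Primrec fun b : ℕ × ((LearnerInput × List ℕ) × ℕ) =>
      2 * (sampleCount b.2.1.1 * gridDenom b.2.1.1 ^ b.2.1.1.1) :=
    nat_mul.comp (const 2) (nat_mul.comp (primrec_sampleCount.comp hx)
      (primrec_pow.comp (primrec_gridDenom.comp hx) (fst.comp hx)))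
  have hR : PrimrecRel fun (k : ℕ) (b : (LearnerInput × List ℕ) × ℕ) => FitsAt b.1.1 b.1.2 b.2 k :=
    (nat_le.comp hC (nat_add.comp hW hT)).and (nat_le.comp hW (nat_add.comp hC hT))
  exact hR.forall_mem_list.comp (list_range.comp (succ.comp (fst.comp (fst.comp fst)))) Primrec.id

lemma primrec_bestCode : Primrec₂ bestCode := by
  have hf : Primrec fun a : LearnerInput × List ℕ => (gridDenom a.1 + 1) ^ a.1.1 :=
    primrec_pow.comp (succ.comp (primrec_gridDenom.comp fst)) (fst.comp fst)
  exact nat_findGreatest hf primrecRel_fits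

lemma primrec_estimate : Primrec₂ estimate := by
  have hM : Primrec fun a : LearnerInput × List ℕ => gridDenom a.1 := primrec_gridDenom.comp fst
  have hg : Primrec₂ fun (a : LearnerInput × List ℕ) (i : ℕ) =>
      (_root_.gridDigit (gridDenom a.1) (bestCode a.1 a.2) i, gridDenom a.1) :=
    Primrec.pair (Primrec.gridDigit (hM.comp fst) (primrec_bestCode.comp (fst.comp fst)
      (snd.comp fst)) snd) (hM.comp fst)
  exact ite (primrec_needsNoSamples.comp fst) (const [(1, 2)])
    (list_map (list_range.comp (fst.comp fst)) hg)

end Computability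

/-! ### Codes of grid vectors and their coefficients -/

/-- The learner that draws samples from the first power and returns a grid vector whose Poisson
binomial distribution is close to their empirical distribution. -/
def gridLearner : PowerLearner where
  next a := if a.2.length < sampleCount a.1 then Sum.inl 1 else Sum.inr (estimate a.1 a.2)
  computable_next := Primrec.to_comp <|
    Primrec.ite (Primrec.nat_lt.comp (Primrec.list_length.comp Primrec.snd)
      (primrec_sampleCount.comp Primrec.fst)) (Primrec.const _)
      (Primrec.sumInr.comp (primrec_estimate.comp Primrec.fst Primrec.snd))

lemma gridDigit_le (M c i : ℕ) : gridDigit M c i ≤ M :=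
  Nat.lt_succ_iff.1 (Nat.mod_lt _ M.succ_pos)

/-- The grid vector encoded by `c`. -/
noncomputable def gridVec (n M c : ℕ) : Fin n → ℝ := fun i => gridDigit M c i / M

lemma gridVec_mem_Icc (n M c : ℕ) (i : Fin n) : gridVec n M c i ∈ Set.Icc (0 : ℝ) 1 :=
  ⟨by unfold gridVec; positivity,
    div_le_one_of_le₀ (by exact_mod_cast gridDigit_le M c i) (Nat.cast_nonneg M)⟩

lemma exists_gridDigit_eq (M n : ℕ) (d : ℕ → ℕ) (hd : ∀ i, d i ≤ M) :
    ∃ c < (M + 1) ^ n, ∀ i < n, gridDigit M c i = d i := by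
  induction n generalizing d with
  | zero => exact ⟨0, by simp, by simp⟩
  | succ n ih =>
    obtain ⟨c, hc, h⟩ := ih (fun i => d (i + 1)) fun i => hd _
    have h0 : d 0 < M + 1 := Nat.lt_succ_of_le (hd 0)
    -- Least significant digit first, as in Horner's scheme.
    refine ⟨d 0 + (M + 1) * c, ?_, fun i hi => ?_⟩
    · have : (M + 1) * (c + 1) ≤ (M + 1) * (M + 1) ^ n := Nat.mul_le_mul_left _ hc
      rw [pow_succ']
      linarith
    · cases i with
      | zero => simp [gridDigit, Nat.mod_eq_of_lt h0]
      | succ i =>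
        rw [← h i (by omega), gridDigit, gridDigit, pow_succ', ← Nat.div_div_eq_div_mul,
          Nat.add_mul_div_left _ _ M.succ_pos, Nat.div_eq_of_lt h0, zero_add]

lemma getD_mulLinear {M d L k : ℕ} (l : List ℕ) (hk : k < L) :
    (mulLinear M d L l).getD k 0 =
      (M - d) * l.getD k 0 + d * (if k = 0 then 0 else l.getD (k - 1) 0) := by
  simp [mulLinear, List.getD_eq_getElem?_getD, hk]

/-- The factor `M ^ i` clears all denominators. Truncation to `L` entries is harmless, since entry
`k` depends only on entries `k` and `k - 1` of the previous row. -/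
lemma weightRow_getD {M : ℕ} (hM : 0 < M) (c L i k : ℕ) (hk : k < L) :
    ((weightRow M c L i).getD k 0 : ℝ) = M ^ i * (genPoly (gridVec i M c)).coeff k := by
  induction i generalizing k with
  | zero => cases k <;> simp [weightRow, genPoly, Polynomial.coeff_one]
  | succ i ih =>
    have e : genPoly (gridVec (i + 1) M c) = genPoly (gridVec i M c) *
        (Polynomial.C (1 - (gridDigit M c i / M : ℝ)) +
          Polynomial.C (gridDigit M c i / M : ℝ) * Polynomial.X) := by
      rw [genPoly, Fin.prod_univ_castSucc]; rfl
    have hM0 : (M : ℝ) ≠ 0 := by exact_mod_cast hM.ne'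
    have hw : (weightRow M c L (i + 1)) = mulLinear M (gridDigit M c i) L (weightRow M c L i) := rfl
    rw [hw, getD_mulLinear _ hk, e, mul_add, Polynomial.coeff_add, Polynomial.coeff_mul_C,
      ← mul_assoc, Nat.cast_add, Nat.cast_mul, Nat.cast_mul,
      Nat.cast_sub (gridDigit_le M c i), ih k hk]
    cases k with
    | zero =>
      simp only [if_true, Nat.cast_zero, mul_zero, add_zero, Polynomial.coeff_mul_X_zero]
      field_simp
      ring
    | succ k =>
      simp only [Nat.add_eq_zero_iff, one_ne_zero, and_false, if_false, Nat.add_sub_cancel,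
        Polynomial.coeff_mul_X, Polynomial.coeff_mul_C]
      rw [ih k (by omega)]
      field_simp
      ring

/-! ### Correctness and sample bound -/

section Correctness

variable {x : LearnerInput}

lemma toleranceDenom_pos (x : LearnerInput) : 0 < toleranceDenom x := by
  unfold toleranceDenom accuracyDenom; positivity

lemma gridDenom_pos (hn : 1 ≤ x.1) : 0 < gridDenom x :=
  Nat.mul_pos hn (toleranceDenom_pos x)

/-- The integer inequalities are the real one multiplied by `gridDenom x ^ x.1 * toleranceDenom x`.
-/
lemma fitsAt_iff (hn : 1 ≤ x.1) (h : List ℕ) (c : ℕ) {k : ℕ} (hk : k ≤ x.1) :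
    FitsAt x h c k ↔ |(h.count k : ℝ) - (genPoly (gridVec x.1 (gridDenom x) c)).coeff k *
      sampleCount x| ≤ 2 * (1 / toleranceDenom x * sampleCount x) := by
  have hM := gridDenom_pos hn
  have hH : (0 : ℝ) < toleranceDenom x := by exact_mod_cast toleranceDenom_pos x
  have hMn : (0 : ℝ) < (gridDenom x : ℝ) ^ x.1 := by positivity
  unfold FitsAt
  rw [← Nat.cast_le (α := ℝ), ← Nat.cast_le (α := ℝ)]
  push_cast
  rw [weightRow_getD hM c _ _ k (Nat.lt_succ_of_le hk)]
  set b := (genPoly (gridVec x.1 (gridDenom x) c)).coeff k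
  set N := (sampleCount x : ℝ)
  set H := (toleranceDenom x : ℝ)
  set T := (gridDenom x : ℝ) ^ x.1
  have hT : 0 < T * H := mul_pos hMn hH
  have e : 2 * (N * T) = T * H * (2 * (1 / H * N)) := by field_simp
  have e2 : T * b * (N * H) = T * H * (b * N) := by ring
  have e3 : (h.count k : ℝ) * (T * H) = T * H * h.count k := by ring
  rw [e, e2, e3, ← mul_add, ← mul_add, mul_le_mul_iff_right₀ hT, mul_le_mul_iff_right₀ hT, abs_le]
  constructor
  · rintro ⟨h1, h2⟩; constructor <;> linarith
  · rintro ⟨h1, h2⟩; constructor <;> linarith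

/-- Rounding every parameter down to the grid costs at most `n / gridDenom x = 1 / toleranceDenom x`
per coefficient; the sampling error contributes as much again. -/
lemma exists_fits (hn : 1 ≤ x.1) {p : Fin x.1 → ℝ} (hp : ∀ i, p i ∈ Set.Icc (0 : ℝ) 1) {h : List ℕ}
    (hh : ∀ k ≤ x.1, |(h.count k : ℝ) - (genPoly p).coeff k * sampleCount x| ≤
      1 / toleranceDenom x * sampleCount x) :
    ∃ c ≤ (gridDenom x + 1) ^ x.1, Fits x h c := by
  have hM : (0 : ℝ) < gridDenom x := by exact_mod_cast gridDenom_pos hn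
  obtain ⟨c, hc, hd⟩ := exists_gridDigit_eq (gridDenom x) x.1
    (fun i => if hi : i < x.1 then ⌊p ⟨i, hi⟩ * gridDenom x⌋₊ else 0) (fun i => by
      split_ifs with hi
      · refine Nat.floor_le_of_le ?_
        exact mul_le_of_le_one_left hM.le (hp _).2
      · exact Nat.zero_le _)
  refine ⟨c, hc.le, fun k hk => ?_⟩
  have hk : k ≤ x.1 := Nat.lt_succ_iff.1 (List.mem_range.1 hk)
  rw [fitsAt_iff hn h c hk]
  have hround (i : Fin x.1) : |p i - gridVec x.1 (gridDenom x) c i| ≤ 1 / gridDenom x := by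
    have hi : gridDigit (gridDenom x) c i = ⌊p i * gridDenom x⌋₊ := by
      rw [hd i i.2, dif_pos i.2]
    have f1 := Nat.floor_le (mul_nonneg (hp i).1 hM.le)
    have f2 := Nat.lt_floor_add_one (p i * gridDenom x)
    have e : p i - gridVec x.1 (gridDenom x) c i =
        (p i * gridDenom x - ⌊p i * gridDenom x⌋₊) / gridDenom x := by
      rw [gridVec, hi]; field_simp
    rw [e, abs_div, abs_of_pos hM]
    refine div_le_div_of_nonneg_right ?_ hM.le
    rw [abs_le]; constructor <;> linarith
  have hsum : ∑ i, |p i - gridVec x.1 (gridDenom x) c i| ≤ 1 / toleranceDenom x := by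
    refine (Finset.sum_le_sum fun i _ => hround i).trans_eq ?_
    have hn0 : (x.1 : ℝ) ≠ 0 := by exact_mod_cast (by omega : x.1 ≠ 0)
    simp only [Finset.sum_const, Finset.card_univ, Fintype.card_fin, nsmul_eq_mul, gridDenom,
      Nat.cast_mul]
    field_simp
  have hcoeff := (abs_genPoly_coeff_sub_le p _ hp (gridVec_mem_Icc x.1 (gridDenom x) c) k).trans hsum
  have e : (h.count k : ℝ) - (genPoly (gridVec x.1 (gridDenom x) c)).coeff k * sampleCount x =
    (h.count k - (genPoly p).coeff k * sampleCount x) +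
      ((genPoly p).coeff k - (genPoly (gridVec x.1 (gridDenom x) c)).coeff k) * sampleCount x := by
    ring
  rw [e]
  refine (abs_add_le _ _).trans ?_
  rw [abs_mul, Nat.abs_cast, two_mul]
  exact add_le_add (hh k hk) (mul_le_mul_of_nonneg_right hcoeff (Nat.cast_nonneg _))

lemma inv_lt_accuracyDenom (hε : 0 < fracVal x.2.1) : 1 / fracVal x.2.1 < accuracyDenom x := by
  have h1 : 0 < x.2.1.1 := by
    rcases Nat.eq_zero_or_pos x.2.1.1 with h | h
    · simp [fracVal, h] at hε
    · exact h
  rw [fracVal, one_div_div, div_lt_iff₀ (by exact_mod_cast h1), accuracyDenom, mul_comm]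
  exact_mod_cast Nat.lt_mul_div_succ x.2.1.2 h1

/-- This fixes the shape of `toleranceDenom`: `n + 1` coefficients, each off by three tolerances,
must stay below the stability threshold. The factor `4 > 3` makes the inequality strict. -/
lemma three_mul_div_toleranceDenom_lt (hε : 0 < fracVal x.2.1) :
    (x.1 + 1 : ℝ) * (3 * (1 / toleranceDenom x)) < (fracVal x.2.1 / (2 * x.1 + 3)) ^ x.1 := by
  have hE := inv_lt_accuracyDenom hε
  have hE0 : (0 : ℝ) < accuracyDenom x := lt_trans (by positivity) hE
  have h1 : 1 / ((2 * x.1 + 3 : ℝ) * accuracyDenom x) ≤ fracVal x.2.1 / (2 * x.1 + 3) := by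
    rw [div_le_div_iff₀ (by positivity) (by positivity)]
    rw [div_lt_iff₀ hε] at hE
    nlinarith
  refine lt_of_lt_of_le ?_ (pow_le_pow_left₀ (by positivity) h1 _)
  have hQ : (0 : ℝ) < ((2 * x.1 + 3 : ℝ) * accuracyDenom x) ^ x.1 := by positivity
  rw [div_pow, one_pow]
  simp only [toleranceDenom, Nat.cast_mul, Nat.cast_add, Nat.cast_pow, Nat.cast_ofNat, Nat.cast_one]
  set Q := ((2 * x.1 + 3 : ℝ) * accuracyDenom x) ^ x.1
  have e : (x.1 + 1 : ℝ) * (3 * (1 / (4 * (x.1 + 1) * Q))) = 3 / 4 * (1 / Q) := by field_simp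
  rw [e]
  linarith [one_div_pos.2 hQ]

lemma isParamEstimate_estimate (hn : 1 ≤ x.1) (hε : 0 < fracVal x.2.1) (hε1 : fracVal x.2.1 < 1)
    (hx : ¬ NeedsNoSamples x) {p : Fin x.1 → unitInterval} {h : List ℕ}
    (hh : ∀ k ≤ x.1, |(h.count k : ℝ) - (genPoly fun i => (p i : ℝ)).coeff k * sampleCount x| ≤
      1 / toleranceDenom x * sampleCount x) :
    IsParamEstimate p (fracVal x.2.1) (estimate x h) := by
  obtain ⟨c₀, hc₀, hfit₀⟩ := exists_fits hn (fun i => (p i).2) hh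
  -- The code found need not be the rounding of `p`; only the fit matters.
  have hfit : Fits x h (bestCode x h) := Nat.findGreatest_spec (P := Fits x h) hc₀ hfit₀
  set c := bestCode x h with hc
  have hH := toleranceDenom_pos x
  have hN : (0 : ℝ) < sampleCount x := by
    rw [sampleCount, if_neg hx]
    have : 0 < 4 * toleranceDenom x ^ 2 * (2 * (x.1 + 1) + confidenceBits x) := by positivity
    exact_mod_cast this
  have hclose : ∑ k ∈ Finset.range (x.1 + 1), |(genPoly fun i => (p i : ℝ)).coeff k -
      (genPoly (gridVec x.1 (gridDenom x) c)).coeff k| < (fracVal x.2.1 / (2 * x.1 + 3)) ^ x.1 := by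
    refine lt_of_le_of_lt ?_ (three_mul_div_toleranceDenom_lt hε)
    have hle (k : ℕ) (hk : k ∈ Finset.range (x.1 + 1)) :
        |(genPoly fun i => (p i : ℝ)).coeff k -
          (genPoly (gridVec x.1 (gridDenom x) c)).coeff k| ≤ 3 * (1 / toleranceDenom x) := by
      have hk' : k ≤ x.1 := Nat.lt_succ_iff.1 (Finset.mem_range.1 hk)
      have h1 := abs_le.1 (hh k hk')
      have h2 := abs_le.1 ((fitsAt_iff hn h c hk').1 (hfit k (by simpa using hk)))
      rw [← mul_le_mul_iff_left₀ hN, ← abs_of_pos hN, ← abs_mul, abs_of_pos hN, abs_le]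
      constructor <;> linarith [h1.1, h1.2, h2.1, h2.2]
    refine (Finset.sum_le_card_nsmul _ _ _ hle).trans_eq ?_
    simp
  obtain ⟨σ, hσ⟩ := exists_perm_abs_sub_le _ _ (fun i => (p i).2) (gridVec_mem_Icc _ _ c) hε hε1.le hclose
  refine ⟨fun i => (gridDigit (gridDenom x) c i, gridDenom x), ?_, σ, ?_⟩
  · rw [estimate, if_neg hx]
    refine List.ext_getElem (by simp) fun i _ _ => by simp [hc]
  · rw [pi_norm_le_iff_of_nonneg hε.le]
    exact hσ

lemma div_lt_two_pow_confidenceBits (hδ : 0 < fracVal x.2.2) :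
    1 / fracVal x.2.2 < 2 ^ confidenceBits x := by
  have h1 : 0 < x.2.2.1 := by
    rcases Nat.eq_zero_or_pos x.2.2.1 with h | h
    · simp [fracVal, h] at hδ
    · exact h
  rw [fracVal, one_div_div, div_lt_iff₀ (by exact_mod_cast h1)]
  have h2 : x.2.2.2 < x.2.2.1 * (x.2.2.2 / x.2.2.1 + 1) := Nat.lt_mul_div_succ _ h1
  have h3 : x.2.2.2 / x.2.2.1 + 1 ≤ 2 ^ confidenceBits x := Nat.lt_pow_succ_log_self (by norm_num) _
  rw [mul_comm]
  exact_mod_cast h2.trans_le (Nat.mul_le_mul_left _ h3)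

/-- The sample count makes the exponent exactly `2 (n + 1) + confidenceBits x`: the first summand
absorbs the union bound, the second absorbs `1 / δ`. -/
lemma mul_exp_sampleCount_le (hδ : 0 < fracVal x.2.2) (hx : ¬ NeedsNoSamples x) :
    2 * (x.1 + 1) * Real.exp (-((1 / toleranceDenom x : ℝ) ^ 2 * sampleCount x / 4)) ≤
      fracVal x.2.2 := by
  have hH : (toleranceDenom x : ℝ) ≠ 0 := by exact_mod_cast (toleranceDenom_pos x).ne'
  have e : (1 / toleranceDenom x : ℝ) ^ 2 * sampleCount x / 4 =
      2 * (x.1 + 1) + confidenceBits x := by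
    rw [sampleCount, if_neg hx]
    push_cast
    field_simp
  have h1 : (2 * (x.1 + 1) : ℝ) ≤ Real.exp (2 * (x.1 + 1)) := by
    linarith [Real.add_one_le_exp (2 * (x.1 + 1) : ℝ)]
  have h2 : (2 : ℝ) ^ confidenceBits x ≤ Real.exp (confidenceBits x) := by
    rw [← Real.exp_one_pow]
    exact pow_le_pow_left₀ (by norm_num) (by linarith [Real.add_one_le_exp (1 : ℝ)]) _
  have h3 := (div_lt_two_pow_confidenceBits hδ).le.trans h2
  rw [div_le_iff₀ hδ] at h3
  rw [e, Real.exp_neg, Real.exp_add, ← div_eq_mul_inv, div_le_iff₀ (by positivity)]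
  nlinarith [mul_le_mul h1 h3 (by norm_num) (Real.exp_pos _).le]

lemma confidenceBits_le (hδ : 0 < fracVal x.2.2) (hδ1 : fracVal x.2.2 < 1) :
    (confidenceBits x : ℝ) ≤ 2 * max 1 (Real.logb 2 (1 / fracVal x.2.2)) := by
  have h1 : 0 < x.2.2.1 := by
    rcases Nat.eq_zero_or_pos x.2.2.1 with h | h
    · simp [fracVal, h] at hδ
    · exact h
  have h2 : 0 < x.2.2.2 := by
    rcases Nat.eq_zero_or_pos x.2.2.2 with h | h
    · simp [fracVal, h] at hδ
    · exact h
  have h3 : x.2.2.1 < x.2.2.2 := by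
    rw [fracVal, div_lt_one (by exact_mod_cast h2)] at hδ1
    exact_mod_cast hδ1
  have h4 : x.2.2.2 / x.2.2.1 ≠ 0 := (Nat.div_pos h3.le h1).ne'
  have h5 : (Nat.log 2 (x.2.2.2 / x.2.2.1) : ℝ) ≤ Real.logb 2 (1 / fracVal x.2.2) := by
    rw [Real.le_logb_iff_rpow_le (by norm_num) (by positivity), Real.rpow_natCast]
    have h6 : ((2 ^ Nat.log 2 (x.2.2.2 / x.2.2.1) : ℕ) : ℝ) ≤ (x.2.2.2 / x.2.2.1 : ℕ) := by
      exact_mod_cast Nat.pow_log_le_self 2 h4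
    rw [fracVal, one_div_div]
    refine le_trans ?_ Nat.cast_div_le
    exact_mod_cast h6
  rw [confidenceBits]
  push_cast
  linarith [le_max_left 1 (Real.logb 2 (1 / fracVal x.2.2)),
    le_max_right 1 (Real.logb 2 (1 / fracVal x.2.2))]

lemma accuracyDenom_le (x : LearnerInput) : (accuracyDenom x : ℝ) ≤ 1 / fracVal x.2.1 + 1 := by
  rw [accuracyDenom, fracVal, one_div_div]
  push_cast
  linarith [Nat.cast_div_le (α := ℝ) (m := x.2.1.2) (n := x.2.1.1)]

/-- Since `b ≥ 2`, every factor, constants included, is at most a small power of `b`, with `m`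
absorbing the confidence bits. The total exponent is `5 + 18 n`, at most `23 n` because `n ≥ 1`. -/
lemma sampleCount_le_mul_pow (hn : 1 ≤ x.1) (hx : ¬ NeedsNoSamples x) {b m : ℝ} (hb : 2 ≤ b)
    (hbn : (x.1 : ℝ) ≤ b) (hbε : 1 / fracVal x.2.1 ≤ b) (hm : 1 ≤ m)
    (hmD : (confidenceBits x : ℝ) ≤ 2 * m) :
    (sampleCount x : ℝ) ≤ m * b ^ (23 * x.1) := by
  have hE : (accuracyDenom x : ℝ) ≤ b ^ 2 := by nlinarith [accuracyDenom_le x]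
  have h1 : (2 * x.1 + 3 : ℝ) ≤ b ^ 3 := by nlinarith [mul_le_mul hb hb (by norm_num) (by linarith)]
  have h2 : (x.1 + 1 : ℝ) ≤ b ^ 2 := by nlinarith
  have h3 : (4 : ℝ) ≤ b ^ 2 := by nlinarith
  have hb0 : 0 ≤ b := by linarith
  have hb1 : 1 ≤ b := by linarith
  have hH : (toleranceDenom x : ℝ) ≤ b ^ (9 * x.1) := by
    simp only [toleranceDenom, Nat.cast_mul, Nat.cast_add, Nat.cast_pow, Nat.cast_ofNat,
      Nat.cast_one]
    calc (4 * (x.1 + 1) * ((2 * x.1 + 3) * accuracyDenom x) ^ x.1 : ℝ)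
        ≤ b ^ 2 * b ^ 2 * (b ^ 3 * b ^ 2) ^ x.1 := by gcongr
      _ = b ^ (4 + 5 * x.1) := by ring
      _ ≤ b ^ (9 * x.1) := pow_le_pow_right₀ hb1 (by omega)
  have h4 : (2 * (x.1 + 1) + confidenceBits x : ℝ) ≤ m * b ^ 3 := by
    have h5 : (2 * x.1 + 4 : ℝ) ≤ b ^ 3 := by nlinarith [mul_le_mul hb hb (by norm_num) (by linarith)]
    have h6 : (2 * (x.1 + 1) : ℝ) ≤ m * (2 * (x.1 + 1)) := le_mul_of_one_le_left (by positivity) hm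
    nlinarith [mul_le_mul_of_nonneg_left h5 (by linarith : 0 ≤ m)]
  rw [sampleCount, if_neg hx]
  push_cast
  calc (4 * (toleranceDenom x : ℝ) ^ 2 * (2 * (x.1 + 1) + confidenceBits x))
      ≤ b ^ 2 * (b ^ (9 * x.1)) ^ 2 * (m * b ^ 3) := by gcongr
    _ = m * b ^ (5 + 18 * x.1) := by ring
    _ ≤ m * b ^ (23 * x.1) := by
      refine mul_le_mul_of_nonneg_left (pow_le_pow_right₀ hb1 (by omega)) (by linarith)

lemma sampleCount_le (hn : 1 ≤ x.1) (hε : 0 < fracVal x.2.1) (hδ : 0 < fracVal x.2.2)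
    (hδ1 : fracVal x.2.2 < 1) :
    (sampleCount x : ℝ) ≤ max 1 (Real.logb 2 (1 / fracVal x.2.2)) *
      (2 : ℝ) ^ ((23 : ℝ) * (x.1 * max (Real.logb 2 (1 / fracVal x.2.1)) (Real.logb 2 x.1))) := by
  by_cases hx : NeedsNoSamples x
  · rw [sampleCount, if_pos hx, Nat.cast_zero]
    positivity
  set B := max (Real.logb 2 (1 / fracVal x.2.1)) (Real.logb 2 x.1) with hB
  have hn0 : (0 : ℝ) < x.1 := by exact_mod_cast hn
  have hpow (y : ℝ) (hy : 0 < y) (hyB : Real.logb 2 y ≤ B) : y ≤ 2 ^ B := by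
    rwa [← Real.logb_le_iff_le_rpow (by norm_num) hy]
  have hbε := hpow _ (one_div_pos.2 hε) (le_max_left _ _)
  have hbn := hpow _ hn0 (le_max_right _ _)
  -- This is where the exceptional case is needed: for `n = 1` and `ε` near `1` the exponent `B`
  -- tends to `0` and could not absorb any constant.
  have hb : (2 : ℝ) ≤ 2 ^ B := by
    by_cases h2 : x.1 = 1
    · refine le_trans ?_ hbε
      have h3 : 2 * x.2.1.1 < x.2.1.2 := not_le.1 fun h => hx ⟨h2, h⟩
      have h1 : 0 < x.2.1.1 := by
        rcases Nat.eq_zero_or_pos x.2.1.1 with h | h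
        · simp [fracVal, h] at hε
        · exact h
      rw [fracVal, one_div_div, le_div_iff₀ (by exact_mod_cast h1)]
      exact_mod_cast h3.le
    · refine le_trans ?_ hbn
      exact_mod_cast (by omega : 2 ≤ x.1)
  refine (sampleCount_le_mul_pow hn hx hb hbn hbε (le_max_left 1 _)
    (confidenceBits_le hδ hδ1)).trans_eq ?_
  rw [← Real.rpow_natCast, ← Real.rpow_mul (by norm_num)]
  congr 2
  push_cast
  ring

lemma gridLearner_next_of_lt {h : List ℕ} (hh : h.length < sampleCount x) :
    gridLearner.next (x, h) = Sum.inl 1 := if_pos hh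

lemma gridLearner_next_of_le {h : List ℕ} (hh : sampleCount x ≤ h.length) :
    gridLearner.next (x, h) = Sum.inr (estimate x h) := if_neg (not_lt.2 hh)

lemma gridLearner_success_of_needsNoSamples (hε : 0 < fracVal x.2.1) (hx : NeedsNoSamples x)
    (hδ : 0 < fracVal x.2.2) (p : Fin x.1 → unitInterval) :
    ENNReal.ofReal (1 - fracVal x.2.2) ≤
      (gridLearner.outputLaw x (pbdPower p) (sampleCount x) []).toOuterMeasure
        {o | ∃ v, o = some v ∧ IsParamEstimate p (fracVal x.2.1) v} := by
  have hN : sampleCount x = 0 := if_pos hx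
  have hest : estimate x [] = [(1, 2)] := if_pos hx
  have h2 : 0 < x.2.1.2 := by
    rcases Nat.eq_zero_or_pos x.2.1.2 with h | h
    · simp [fracVal, h] at hε
    · exact h
  have hhalf : 1 / 2 ≤ fracVal x.2.1 := by
    rw [fracVal, div_le_div_iff₀ (by norm_num) (by exact_mod_cast h2)]
    rw [one_mul, mul_comm]
    exact_mod_cast hx.2
  -- The point `1 / 2` is within `1 / 2 ≤ ε` of all of `[0, 1]`.
  have hgood : IsParamEstimate p (fracVal x.2.1) [(1, 2)] := by
    obtain ⟨n, ε, δ⟩ := x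
    obtain rfl : n = 1 := hx.1
    refine ⟨fun _ => (1, 2), by simp, 1, ?_⟩
    rw [pi_norm_le_iff_of_nonneg hε.le]
    intro i
    refine le_trans ?_ hhalf
    have h0 := (p i).2.1
    have h1 := (p i).2.2
    rw [Real.norm_eq_abs, abs_le, fracVal]
    norm_num
    constructor <;> linarith
  rw [hN, PowerLearner.outputLaw, gridLearner_next_of_le (by simp [hN]), hest]
  simp only [PMF.toOuterMeasure_pure_apply]
  rw [if_pos ⟨_, rfl, hgood⟩]
  exact ENNReal.ofReal_le_one.2 (by linarith)

lemma gridLearner_success (hn : 1 ≤ x.1) (hε : 0 < fracVal x.2.1) (hε1 : fracVal x.2.1 < 1)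
    (hδ : 0 < fracVal x.2.2) (p : Fin x.1 → unitInterval) :
    ENNReal.ofReal (1 - fracVal x.2.2) ≤
      (gridLearner.outputLaw x (pbdPower p) (sampleCount x) []).toOuterMeasure
        {o | ∃ v, o = some v ∧ IsParamEstimate p (fracVal x.2.1) v} := by
  by_cases hx : NeedsNoSamples x
  · exact gridLearner_success_of_needsNoSamples hε hx hδ p
  have hH : (1 : ℝ) ≤ toleranceDenom x := by exact_mod_cast toleranceDenom_pos x
  refine gridLearner.le_outputLaw x (pbdPower p) (sampleCount x) x.1 _
    (genPoly_coeff_nonneg _ fun i => (p i).2) (genPoly_coeff_sum _) (pbdPower_one_apply p)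
    (fun k hk => genPoly_coeff_of_lt _ hk) (η := 1 / toleranceDenom x) (by positivity)
    (div_le_one_of_le₀ hH (by linarith)) (mul_exp_sampleCount_le hδ hx)
    (fun h hh => gridLearner_next_of_lt hh)
    (fun h hh => ⟨_, gridLearner_next_of_le hh.ge, fun hdev =>
      ⟨_, rfl, isParamEstimate_estimate hn hε hε1 hx hdev⟩⟩)

end Correctness

theorem theorem4 :
    ∃ (A : PowerLearner) (C : ℝ), 0 < C ∧
      ∀ (n : ℕ) (ε δ : ℕ × ℕ), 1 ≤ n →
        0 < fracVal ε → fracVal ε < 1 → 0 < fracVal δ → fracVal δ < 1 →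
        ∃ N : ℕ,
          (N : ℝ) ≤ max 1 (Real.logb 2 (1 / fracVal δ)) *
            (2 : ℝ) ^ (C * (n * max (Real.logb 2 (1 / fracVal ε)) (Real.logb 2 n))) ∧
          A.DrawsAtMost (n, ε, δ) N ∧
          A.QueriesOnly (n, ε, δ) n ∧
          ∀ p : Fin n → unitInterval,
            ENNReal.ofReal (1 - fracVal δ) ≤
              (A.outputLaw (n, ε, δ) (pbdPower p) N []).toOuterMeasure
                {o | ∃ v, o = some v ∧ IsParamEstimate p (fracVal ε) v} := by
  refine ⟨gridLearner, 23, by norm_num, fun n ε δ hn hε hε1 hδ hδ1 =>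
    ⟨sampleCount (n, ε, δ), sampleCount_le (x := (n, ε, δ)) hn hε hδ hδ1,
      fun h hh => ⟨_, gridLearner_next_of_le hh.ge⟩, fun h k hk => ?_,
      gridLearner_success (x := (n, ε, δ)) hn hε hε1 hδ⟩⟩
  rcases lt_or_ge h.length (sampleCount (n, ε, δ)) with hlt | hge
  · rw [gridLearner_next_of_lt hlt] at hk
    obtain rfl := Sum.inl.inj hk
    exact ⟨le_rfl, hn⟩
  · rw [gridLearner_next_of_le hge] at hk
    cases hk
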